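/- Let $a_1,a_2>0$ and let $H_1,H_2$ be probability measures on $\mathbb{R}$. A random probability measure $P$ is a Dirichlet process, $P\sim DP(a,H)$, if for every finite measurable partition $A_1,\dots,A_k$ ($k\ge 2$) of the space, $(P(A_1),\dots,P(A_k))\sim\mathrm{Dirichlet}(aH(A_1),\dots,aH(A_k))$, where a coordinate with parameter $0$ is almost surely $0$. Let $P\sim DP(a_1,H_1)$ and $Q\sim DP(a_2,H_2)$ be defined on a common probability space and given by their Ferguson series. That is, almost surely $$P=\sum_{i=1}^\infty \frac{L^{-1}(\Gamma_i)}{\sum_{j=1}^\infty L^{-1}(\Gamma_j)}\,\delta_{Y_i},\qquad \Gamma_i=E_1+\dots+E_i,$$ where $(a,H)=(a_1,H_1)$, $(E_i)_{i\ge1}$ are i.i.d. exponential with mean $1$, $(Y_i)_{i\ge1}$ are i.i.d. with law $H$, the sequences $(E_i)$ and $(Y_i)$ are independent, $L(x)=a\int_x^\infty t^{-1}e^{-t}\,dt$ for $x>0$, and $L^{-1}(y)=\inf\{x>0: L(x)\le y\}$; and $Q$ is given in the same way by sequences $(E'_i)$, $(Y'_i)$ with $(a,H)=(a_2,H_2)$.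 (No assumption is made on the joint law of the sequences of $P$ and those of $Q$.) For $N\ge 1$ let $P_N$ be the Zarepour–Al-Labadi approximation built from the same variables, $$P_N=\sum_{i=1}^N \frac{G_{a/N}^{-1}(\Gamma_i/\Gamma_{N+1})}{\sum_{j=1}^N G_{a/N}^{-1}(\Gamma_j/\Gamma_{N+1})}\,\delta_{Y_i},$$ with $a=a_1$, where $G_{\alpha}^{-1}(p)$ is the $(1-p)$-quantile of the $\mathrm{Gamma}(\alpha,1)$ distribution, and let $Q_N$ be the corresponding approximation of $Q$, with $a=a_2$. For probability measures on $\mathbb{R}$ with cdf's $F,G$ let $d_{CvM}(F,G)=\int_{-\infty}^{\infty}(F(x)-G(x))^2\,G(dx)$. Then, almost surely, $$d_{CvM}(P_{N_1},Q_{N_2})\longrightarrow d_{CvM}(P,Q)\qquad\text{as } N_1,N_2\to\infty.$$ -/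

import Mathlib

open MeasureTheory ProbabilityTheory Filter Topology

noncomputable section

namespace DPApprox

/-- The `Gamma(α, 1)` distribution (shape `α`, rate `1`), with the usual convention that it is the
point mass at `0` when the shape vanishes. -/
def gammaLaw (α : ℝ) : Measure ℝ :=
  if 0 < α then gammaMeasure α 1 else Measure.dirac 0

/-- The Dirichlet distribution with parameters `α i ≥ 0`, not all zero: the law of
`(Z i / ∑ j, Z j) i`, where the `Z i ∼ Gamma(α i, 1)` are independent. A coordinate with
`α i = 0` is almost surely `0`. -/
def dirichletLaw {k : ℕ} (α : Fin k → ℝ) : Measure (Fin k → ℝ) :=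
  (Measure.pi fun i => gammaLaw (α i)).map fun z i => z i / ∑ j, z j

/-- The random probability measure `P` (a Markov kernel from `Ω`) is a Dirichlet process with
concentration parameter `a` and base measure `H`, i.e. `P ∼ DP(a, H)`: for every finite measurable
partition `A` of the space, `(P(A i)) i` has the Dirichlet distribution with parameters
`(a H(A i)) i`. Null sets are covered by the convention in `dirichletLaw`: if `H(A i) = 0`, then
`P(A i) = 0` almost surely. -/
def IsDirichletProcess {Ω X : Type*} [MeasurableSpace Ω] [MeasurableSpace X]
    (μ : Measure Ω) (P : Kernel Ω X) [IsMarkovKernel P] (a : ℝ) (H : Measure X) : Prop :=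
  ∀ k : ℕ, 2 ≤ k → ∀ A : Fin k → Set X, (∀ i, MeasurableSet (A i)) →
    Pairwise (fun i j => Disjoint (A i) (A j)) → (⋃ i, A i) = Set.univ →
    HasLaw (fun ω i => (P ω).real (A i)) (dirichletLaw fun i => a * H.real (A i)) μ

/-- The random inputs of the series: `E` is i.i.d. exponential with mean `1`, `Y` is i.i.d. with
law `H`, and the two sequences are independent of each other. (`E i`, `Y i` stand for the
`(i + 1)`-st terms of sequences numbered from `1`.) -/
structure IsSeriesInput {Ω : Type*} [MeasurableSpace Ω] (μ : Measure Ω) (H : Measure ℝ)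
    (E Y : ℕ → Ω → ℝ) : Prop where
  hasLaw_exp : ∀ i, HasLaw (E i) (expMeasure 1) μ
  iIndep_exp : iIndepFun E μ
  hasLaw_atom : ∀ i, HasLaw (Y i) H μ
  iIndep_atom : iIndepFun Y μ
  indep : IndepFun (fun ω i => E i ω) (fun ω i => Y i ω) μ

/-- The partial sum `Γ_n = E_1 + ⋯ + E_n`. -/
def arrival (e : ℕ → ℝ) (n : ℕ) : ℝ := ∑ j ∈ Finset.range n, e j

/-- `L(x) = a ∫_x^∞ t⁻¹ e⁻ᵗ dt`, for `x > 0`. -/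
def levyTail (a x : ℝ) : ℝ := a * ∫ t in Set.Ioi x, t⁻¹ * Real.exp (-t)

/-- The inverse `L⁻¹(y) = inf {x > 0 : L(x) ≤ y}` of the decreasing bijection `L` of `(0, ∞)`. -/
def levyTailInv (a y : ℝ) : ℝ := sInf {x : ℝ | 0 < x ∧ levyTail a x ≤ y}

/-- The series `P = ∑_{i ≥ 1} J_i δ_{Y_i}` with `J_i = L⁻¹(Γ_i) / ∑_j L⁻¹(Γ_j)`, for given values
`e` of the exponential variables and `y` of the atoms. -/
def seriesDP (a : ℝ) (e y : ℕ → ℝ) : Measure ℝ :=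
  Measure.sum fun i => ENNReal.ofReal
    (levyTailInv a (arrival e (i + 1)) / ∑' j, levyTailInv a (arrival e (j + 1))) •
      Measure.dirac (y i)

/-- The co-cdf `G_α(x) = Pr(Z > x)` of `Z ∼ Gamma(α, 1)`. -/
def gammaCoCdf (α x : ℝ) : ℝ := (gammaMeasure α 1).real (Set.Ioi x)

/-- `G_α⁻¹(p)`, `0 < p < 1`: the `(1 - p)`-quantile of the `Gamma(α, 1)` distribution. -/
def gammaCoCdfInv (α p : ℝ) : ℝ := sInf {x : ℝ | gammaCoCdf α x ≤ p}

/-- The finite approximation `P_N = ∑_{i = 1}^N J_i δ_{Y_i}` with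
`J_i = G_{a/N}⁻¹(Γ_i / Γ_{N+1}) / ∑_{j = 1}^N G_{a/N}⁻¹(Γ_j / Γ_{N+1})`. -/
def approxDP (a : ℝ) (e y : ℕ → ℝ) (N : ℕ) : Measure ℝ :=
  ∑ i ∈ Finset.range N, ENNReal.ofReal
    (gammaCoCdfInv (a / N) (arrival e (i + 1) / arrival e (N + 1)) /
      ∑ j ∈ Finset.range N, gammaCoCdfInv (a / N) (arrival e (j + 1) / arrival e (N + 1))) •
      Measure.dirac (y i)

/-- The Cramér–von Mises distance `∫ (F(x) - G(x))² G(dx)`, where `F`, `G` are the cdf's of the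
probability measures `p`, `q` on the line. -/
def cvmDist (p q : Measure ℝ) : ℝ :=
  ∫ x, (p.real (Set.Iic x) - q.real (Set.Iic x)) ^ 2 ∂q

end DPApprox

end

/-! The argument is pathwise. By the strong law, almost surely all `E i` are positive and `Γ_n / n →
1`; fix such an outcome. Since `1 / Γ(α) ~ α` as `α → 0`, the tail satisfies `N G_{a/N}(x) → L(x)`.
As `N Γ_i / Γ_{N+1} → Γ_i`, inverting monotone functions gives convergence of each unnormalized
weight to `L⁻¹(Γ_i)` (`tendsto_gammaCoCdfInv`). A Markov-type bound of order `1/2` on the Gamma tail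
dominates the weights by a multiple of `1 / i²`, uniformly in large `N` (`exists_dominatedWeights`).
Dominated convergence for series then passes to the limit in the normalizer, in both cdfs at each
point, and in the distance, which is a series over the fixed atoms of `Q` (`tendsto_cvmDist`). -/

namespace DPApprox

/-! ### Upper incomplete Gamma function -/

/-- The upper incomplete Gamma function `Γ(s, x) = ∫_x^∞ t^(s-1) e⁻ᵗ dt`. -/
noncomputable def upperGamma (s x : ℝ) : ℝ :=
  ∫ t in Set.Ioi x, Real.exp (-t) * t ^ (s - 1)

lemma exp_neg_mul_rpow_le {s r x t : ℝ} (hr : 0 ≤ r) (hx : 0 < x) (ht : x < t) :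
    Real.exp (-t) * t ^ (s - 1) ≤ x ^ (-r) * (Real.exp (-t) * t ^ (s + r - 1)) := by
  have ht0 : 0 < t := hx.trans ht
  have h1 : t ^ (s - 1) = t ^ (-r) * t ^ (s + r - 1) := by
    rw [← Real.rpow_add ht0]; congr 1; ring
  have h2 : t ^ (-r) ≤ x ^ (-r) := Real.rpow_le_rpow_of_nonpos hx ht.le (by linarith)
  calc Real.exp (-t) * t ^ (s - 1) = t ^ (-r) * (Real.exp (-t) * t ^ (s + r - 1)) := by
        rw [h1]; ring
    _ ≤ _ := by gcongr

lemma measurable_exp_neg_mul_rpow (s : ℝ) :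
    Measurable fun t : ℝ => Real.exp (-t) * t ^ (s - 1) := by fun_prop

lemma integrableOn_upperGamma {s x : ℝ} (hs : 0 ≤ s) (hx : 0 < x) :
    IntegrableOn (fun t : ℝ => Real.exp (-t) * t ^ (s - 1)) (Set.Ioi x) := by
  have h := ((Real.GammaIntegral_convergent (s := s + 1) (by linarith)).mono_set
    (Set.Ioi_subset_Ioi hx.le)).const_mul (x ^ (-1 : ℝ))
  refine Integrable.mono' h (measurable_exp_neg_mul_rpow s).aestronglyMeasurable ?_
  refine (ae_restrict_iff' measurableSet_Ioi).2 (ae_of_all _ fun t ht => ?_)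
  have ht0 : 0 < t := hx.trans ht
  rw [Real.norm_of_nonneg (by positivity)]
  exact exp_neg_mul_rpow_le zero_le_one hx ht

/-- Markov-type inequality of order `1/2`, valid down to `s = 0`. An order `r < 1` gives quantiles
of size `p ^ (-1/r)`, summable along `p ~ i / N`; order `1` would only give the harmonic series. -/
lemma upperGamma_le {s x : ℝ} (hs : 0 ≤ s) (hx : 0 < x) :
    upperGamma s x ≤ x ^ (-(1 / 2) : ℝ) * Real.Gamma (s + 1 / 2) := by
  have hs' : 0 < s + 1 / 2 := by linarith
  have hi := Real.GammaIntegral_convergent hs'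
  rw [Real.Gamma_eq_integral hs', ← integral_const_mul]
  refine (setIntegral_mono_on (integrableOn_upperGamma hs hx)
    ((hi.mono_set (Set.Ioi_subset_Ioi hx.le)).const_mul (x ^ (-(1 / 2) : ℝ)))
    measurableSet_Ioi fun t ht => exp_neg_mul_rpow_le (by norm_num) hx ht).trans ?_
  refine setIntegral_mono_set (hi.const_mul _) ?_ (Set.Ioi_subset_Ioi hx.le).eventuallyLE
  refine (ae_restrict_iff' measurableSet_Ioi).2 (ae_of_all _ fun t ht => ?_)
  have ht0 : 0 < t := ht
  simp only [Pi.zero_apply]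
  positivity

lemma tendsto_upperGamma {x : ℝ} (hx : 0 < x) :
    Tendsto (fun s => upperGamma s x) (𝓝[>] 0) (𝓝 (upperGamma 0 x)) := by
  -- For `0 < s < 1`, the exponent `-1` dominates on `t ≤ 1` and the exponent `0` on `t ≥ 1`; their
  -- sum covers both.
  refine tendsto_integral_filter_of_dominated_convergence
    (fun t => Real.exp (-t) * t ^ ((0 : ℝ) - 1) + Real.exp (-t) * t ^ ((1 : ℝ) - 1)) ?_ ?_
    ((integrableOn_upperGamma le_rfl hx).add (integrableOn_upperGamma zero_le_one hx)) ?_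
  · exact Eventually.of_forall fun s => (measurable_exp_neg_mul_rpow s).aestronglyMeasurable
  · have h1 : ∀ᶠ s : ℝ in 𝓝[>] 0, s ∈ Set.Ioo (0 : ℝ) 1 := Ioo_mem_nhdsGT one_pos
    filter_upwards [h1] with s hs
    refine (ae_restrict_iff' measurableSet_Ioi).2 (ae_of_all _ fun t ht => ?_)
    have ht0 : 0 < t := hx.trans ht
    rw [Real.norm_of_nonneg (by positivity), ← mul_add]
    gcongr
    rcases le_total t 1 with h | h
    · have := Real.rpow_le_rpow_of_exponent_ge ht0 h (show (0 : ℝ) - 1 ≤ s - 1 by linarith [hs.1])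
      have h0 : 0 < t ^ ((1 : ℝ) - 1) := by positivity
      linarith
    · have := Real.rpow_le_rpow_of_exponent_le h (show s - 1 ≤ (1 : ℝ) - 1 by linarith [hs.2])
      have h0 : 0 < t ^ ((0 : ℝ) - 1) := by positivity
      linarith
  · refine (ae_restrict_iff' measurableSet_Ioi).2 (ae_of_all _ fun t ht => ?_)
    have ht0 : 0 < t := hx.trans ht
    have hc : Continuous fun s : ℝ => Real.exp (-t) * t ^ (s - 1) :=
      continuous_const.mul ((Real.continuous_const_rpow ht0.ne').comp
        (continuous_id.sub continuous_const))
    exact (hc.tendsto 0).mono_left nhdsWithin_le_nhds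

lemma upperGamma_zero_sub {x x' : ℝ} (hx : 0 < x) (h : x ≤ x') :
    upperGamma 0 x = (∫ t in x..x', Real.exp (-t) * t ^ ((0 : ℝ) - 1)) + upperGamma 0 x' := by
  rw [upperGamma, upperGamma, intervalIntegral.integral_of_le h, ← Set.Ioc_union_Ioi_eq_Ioi h]
  have hi := integrableOn_upperGamma le_rfl hx
  exact setIntegral_union (Set.Ioc_disjoint_Ioi le_rfl) measurableSet_Ioi
    (hi.mono_set Set.Ioc_subset_Ioi_self) (hi.mono_set (Set.Ioi_subset_Ioi h))

lemma intervalIntegrable_upperGamma_zero {x x' : ℝ} (hx : 0 < x) (h : x ≤ x') :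
    IntervalIntegrable (fun t : ℝ => Real.exp (-t) * t ^ ((0 : ℝ) - 1)) volume x x' :=
  (intervalIntegrable_iff_integrableOn_Ioc_of_le h).2
    ((integrableOn_upperGamma le_rfl hx).mono_set Set.Ioc_subset_Ioi_self)

lemma upperGamma_zero_lt {x x' : ℝ} (hx : 0 < x) (h : x < x') :
    upperGamma 0 x' < upperGamma 0 x := by
  rw [upperGamma_zero_sub hx h.le]
  have := intervalIntegral.intervalIntegral_pos_of_pos_on
    (intervalIntegrable_upperGamma_zero hx h.le)
    (fun t ht => by have : 0 < t := hx.trans ht.1; positivity) h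
  linarith

lemma upperGamma_nonneg {s x : ℝ} (hx : 0 ≤ x) : 0 ≤ upperGamma s x :=
  setIntegral_nonneg measurableSet_Ioi fun t ht => by
    have ht0 : 0 < t := lt_of_le_of_lt hx ht
    positivity

lemma exists_lt_upperGamma_zero (y : ℝ) : ∃ x > 0, y < upperGamma 0 x := by
  -- Chosen so that `e⁻¹ log (1 / x) = 1 + |y|`; on `[x, 1]` the integrand is at least `e⁻¹ / t`.
  set x := Real.exp (-(1 + |y|) * Real.exp 1) with hxd
  have hx : 0 < x := Real.exp_pos _
  have hx1 : x ≤ 1 := Real.exp_le_one_iff.2 (by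
    have : 0 ≤ (1 + |y|) * Real.exp 1 := by positivity
    linarith)
  refine ⟨x, hx, ?_⟩
  have h1 : ∫ t in x..1, Real.exp (-1) * t⁻¹ = 1 + |y| := by
    rw [intervalIntegral.integral_const_mul, integral_inv_of_pos hx one_pos, one_div,
      Real.log_inv, hxd, Real.log_exp]
    have : Real.exp (-1) * Real.exp 1 = 1 := by rw [← Real.exp_add]; simp
    linear_combination (1 + |y|) * this
  have h2 : ∫ t in x..1, Real.exp (-1) * t⁻¹ ≤
      ∫ t in x..1, Real.exp (-t) * t ^ ((0 : ℝ) - 1) := by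
    refine intervalIntegral.integral_mono_on hx1 ?_ (intervalIntegrable_upperGamma_zero hx hx1) ?_
    · refine IntervalIntegrable.const_mul (intervalIntegral.intervalIntegrable_inv
        (fun t ht => ?_) continuousOn_id) _
      rw [Set.uIcc_of_le hx1] at ht
      exact (hx.trans_le ht.1).ne'
    · intro t ht
      have ht0 : 0 < t := hx.trans_le ht.1
      rw [zero_sub, Real.rpow_neg_one]
      have := ht.2
      gcongr
  have h3 : 0 ≤ upperGamma 0 1 := upperGamma_nonneg zero_le_one
  rw [h1] at h2
  rw [upperGamma_zero_sub hx hx1]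
  linarith [le_abs_self y]

/-! ### Gamma tails, the Lévy tail and their inverses -/

lemma levyTail_eq (a x : ℝ) : levyTail a x = a * upperGamma 0 x := by
  simp only [levyTail, upperGamma, zero_sub, Real.rpow_neg_one, mul_comm]

lemma gammaCoCdf_eq {α x : ℝ} (hα : 0 < α) (hx : 0 ≤ x) :
    gammaCoCdf α x = (Real.Gamma α)⁻¹ * upperGamma α x := by
  rw [gammaCoCdf, measureReal_def, gammaMeasure, withDensity_apply _ measurableSet_Ioi, upperGamma,
    ← integral_const_mul]
  simp only [gammaPDF]
  rw [← integral_eq_lintegral_of_nonneg_ae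
    (ae_of_all _ fun t => gammaPDFReal_nonneg hα one_pos t)
    (measurable_gammaPDFReal α 1).aestronglyMeasurable]
  refine setIntegral_congr_fun measurableSet_Ioi fun t ht => ?_
  have ht0 : 0 ≤ t := hx.trans (le_of_lt ht)
  simp only [gammaPDFReal, if_pos ht0, Real.one_rpow, one_mul]
  ring

lemma gammaCoCdf_antitone {α : ℝ} (hα : 0 < α) : Antitone (gammaCoCdf α) := fun x y h => by
  have := isProbabilityMeasure_gammaMeasure hα one_pos
  exact measureReal_mono (Set.Ioi_subset_Ioi h)

lemma gammaCoCdf_of_nonpos {α x : ℝ} (hα : 0 < α) (hx : x ≤ 0) : gammaCoCdf α x = 1 := by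
  have := isProbabilityMeasure_gammaMeasure hα one_pos
  refine le_antisymm measureReal_le_one ?_
  have h0 : gammaCoCdf α 0 = 1 := by
    rw [gammaCoCdf_eq hα le_rfl, upperGamma, ← Real.Gamma_eq_integral hα,
      inv_mul_cancel₀ (Real.Gamma_pos_of_pos hα).ne']
  rw [← h0]
  exact gammaCoCdf_antitone hα hx

/-- Isolates the factor `α` responsible for the `1 / N` decay; the other factor tends to `1` as `α →
0`. -/
lemma inv_Gamma_eq {α : ℝ} (hα : 0 < α) :
    (Real.Gamma α)⁻¹ = α * (Real.Gamma (α + 1))⁻¹ := by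
  rw [Real.Gamma_add_one hα.ne', mul_inv, mul_inv_cancel_left₀ hα.ne']

lemma tendsto_div_natCast {a : ℝ} (ha : 0 < a) :
    Tendsto (fun N : ℕ => a / N) atTop (𝓝[>] 0) := by
  refine tendsto_nhdsWithin_iff.2 ⟨tendsto_const_div_atTop_nhds_zero_nat a, ?_⟩
  filter_upwards [eventually_gt_atTop 0] with N hN
  have : (0 : ℝ) < N := by exact_mod_cast hN
  exact div_pos ha this

lemma tendsto_Gamma_add {a c : ℝ} (ha : 0 < a) (hc : 0 < c) :
    Tendsto (fun N : ℕ => Real.Gamma (a / N + c)) atTop (𝓝 (Real.Gamma c)) := by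
  have h1 : Tendsto (fun N : ℕ => a / N + c) atTop (𝓝 c) := by
    simpa using ((tendsto_div_natCast ha).mono_right nhdsWithin_le_nhds).add_const c
  exact (Real.differentiableAt_Gamma fun m => by
    have : (0 : ℝ) ≤ m := m.cast_nonneg
    linarith).continuousAt.tendsto.comp h1

lemma tendsto_natCast_mul_gammaCoCdf {a x : ℝ} (ha : 0 < a) (hx : 0 < x) :
    Tendsto (fun N : ℕ => N * gammaCoCdf (a / N) x) atTop (𝓝 (levyTail a x)) := by
  have h1 := ((tendsto_Gamma_add ha one_pos).inv₀ (by simp)).const_mul a |>.mul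
    ((tendsto_upperGamma hx).comp (tendsto_div_natCast ha))
  rw [levyTail_eq]
  simp only [Real.Gamma_one, inv_one, mul_one] at h1
  refine h1.congr' ?_
  filter_upwards [eventually_gt_atTop 0] with N hN
  have hN' : (0 : ℝ) < N := by exact_mod_cast hN
  have hα : 0 < a / N := div_pos ha hN'
  simp only [Function.comp]
  rw [gammaCoCdf_eq hα hx.le, inv_Gamma_eq hα]
  field_simp

lemma nonneg_of_gammaCoCdf_le {α p x : ℝ} (hα : 0 < α) (hp : p < 1) (h : gammaCoCdf α x ≤ p) :
    0 ≤ x := by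
  by_contra! hx
  rw [gammaCoCdf_of_nonpos hα hx.le] at h
  linarith

lemma gammaCoCdfInv_nonneg {α p : ℝ} (hα : 0 < α) (hp : p < 1) : 0 ≤ gammaCoCdfInv α p :=
  Real.sInf_nonneg fun _ hx => nonneg_of_gammaCoCdf_le hα hp hx

lemma gammaCoCdfInv_le_of_le {α p x : ℝ} (hα : 0 < α) (hp : p < 1) (h : gammaCoCdf α x ≤ p) :
    gammaCoCdfInv α p ≤ x :=
  csInf_le ⟨0, fun _ hx => nonneg_of_gammaCoCdf_le hα hp hx⟩ h

lemma rpow_neg_half_sq {c : ℝ} (hc : 0 < c) : (c ^ 2) ^ (-(1 / 2) : ℝ) = c⁻¹ := by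
  rw [Real.rpow_neg (by positivity), ← Real.sqrt_eq_rpow, Real.sqrt_sq hc.le]

/-- The point solves `x ^ (-1/2) Γ(α + 1/2) / Γ(α) = p`, the bound of `upperGamma_le` set equal to
`p`. -/
lemma gammaCoCdf_sq_le {α p : ℝ} (hα : 0 < α) (hp : 0 < p) :
    gammaCoCdf α (((Real.Gamma α)⁻¹ * Real.Gamma (α + 1 / 2) / p) ^ 2) ≤ p := by
  have h1 := Real.Gamma_pos_of_pos hα
  have h2 := Real.Gamma_pos_of_pos (show 0 < α + 1 / 2 by linarith)
  set c := (Real.Gamma α)⁻¹ * Real.Gamma (α + 1 / 2) / p with hc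
  have hc0 : 0 < c := by positivity
  rw [gammaCoCdf_eq hα (by positivity)]
  calc _ ≤ (Real.Gamma α)⁻¹ * ((c ^ 2) ^ (-(1 / 2) : ℝ) * Real.Gamma (α + 1 / 2)) := by
        gcongr; exact upperGamma_le hα.le (by positivity)
    _ = p := by rw [rpow_neg_half_sq hc0, hc]; field_simp

lemma gammaCoCdfInv_le {α p : ℝ} (hα : 0 < α) (hp : 0 < p) (hp1 : p < 1) :
    gammaCoCdfInv α p ≤ ((Real.Gamma α)⁻¹ * Real.Gamma (α + 1 / 2) / p) ^ 2 :=
  gammaCoCdfInv_le_of_le hα hp1 (gammaCoCdf_sq_le hα hp)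

lemma le_gammaCoCdfInv {α p x : ℝ} (hα : 0 < α) (hp : 0 < p) (h : p < gammaCoCdf α x) :
    x ≤ gammaCoCdfInv α p := by
  refine le_csInf ⟨_, gammaCoCdf_sq_le hα hp⟩ fun z hz => ?_
  by_contra! hzx
  exact absurd (h.trans_le (gammaCoCdf_antitone hα hzx.le)) (not_lt.2 hz)

lemma levyTail_lt {a x x' : ℝ} (ha : 0 < a) (hx : 0 < x) (h : x < x') :
    levyTail a x' < levyTail a x := by
  rw [levyTail_eq, levyTail_eq]
  exact mul_lt_mul_of_pos_left (upperGamma_zero_lt hx h) ha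

lemma levyTailInv_set_nonempty {a y : ℝ} (ha : 0 < a) (hy : 0 < y) :
    {x : ℝ | 0 < x ∧ levyTail a x ≤ y}.Nonempty := by
  have hg := Real.Gamma_pos_of_pos (show (0 : ℝ) < 0 + 1 / 2 by norm_num)
  set c := a * Real.Gamma (0 + 1 / 2) / y with hc
  have hc0 : 0 < c := by positivity
  refine ⟨c ^ 2, by positivity, ?_⟩
  rw [levyTail_eq]
  calc _ ≤ a * ((c ^ 2) ^ (-(1 / 2) : ℝ) * Real.Gamma (0 + 1 / 2)) := by
        gcongr; exact upperGamma_le le_rfl (by positivity)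
    _ = y := by rw [rpow_neg_half_sq hc0, hc]; field_simp

lemma levyTailInv_pos {a y : ℝ} (ha : 0 < a) (hy : 0 < y) : 0 < levyTailInv a y := by
  obtain ⟨x, hx, hxy⟩ := exists_lt_upperGamma_zero (y / a)
  refine hx.trans_le (le_csInf (levyTailInv_set_nonempty ha hy) fun z hz => ?_)
  by_contra! hzx
  have h1 := (levyTail_lt ha hz.1 hzx).trans_le hz.2
  rw [levyTail_eq] at h1
  rw [div_lt_iff₀ ha] at hxy
  linarith

/-- Pointwise convergence of monotone functions passes to their inverses: test the tails at points
on either side of `L⁻¹(y)`. Strict monotonicity of `L` makes the comparisons with `y` strict. -/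
lemma tendsto_gammaCoCdfInv {a y : ℝ} (ha : 0 < a) (hy : 0 < y) {p : ℕ → ℝ}
    (hp : Tendsto (fun N : ℕ => N * p N) atTop (𝓝 y)) :
    Tendsto (fun N : ℕ => gammaCoCdfInv (a / N) (p N)) atTop (𝓝 (levyTailInv a y)) := by
  have hN : ∀ᶠ N : ℕ in atTop, (0 : ℝ) < N := by
    filter_upwards [eventually_gt_atTop 0] with N hN
    exact_mod_cast hN
  have hp0 : ∀ᶠ N : ℕ in atTop, 0 < p N := by
    filter_upwards [hN, hp.eventually (lt_mem_nhds hy)] with N h1 h2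
    exact (pos_iff_pos_of_mul_pos h2).1 h1
  have hp1 : ∀ᶠ N : ℕ in atTop, p N < 1 := by
    filter_upwards [hN, hp.eventually (gt_mem_nhds (lt_add_one y)),
      tendsto_natCast_atTop_atTop.eventually (eventually_ge_atTop (y + 1))] with N h1 h2 h3
    by_contra! h
    nlinarith
  rw [tendsto_order]
  constructor
  · intro x hx
    -- The maximum keeps the test point `z` positive; the tails are only known to converge there.
    have hm : max x (levyTailInv a y / 2) < levyTailInv a y :=
      max_lt hx (half_lt_self (levyTailInv_pos ha hy))
    obtain ⟨z, hz, hzu⟩ := exists_between hm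
    have hz0 : 0 < z :=
      (half_pos (levyTailInv_pos ha hy)).trans ((le_max_right _ _).trans_lt hz)
    have hyz : y < levyTail a z := by
      by_contra! h
      have hb : BddBelow {x : ℝ | 0 < x ∧ levyTail a x ≤ y} := ⟨0, fun _ h => h.1.le⟩
      exact absurd (csInf_le hb ⟨hz0, h⟩) (not_le.2 hzu)
    filter_upwards [hN, hp0, hp.eventually_lt (tendsto_natCast_mul_gammaCoCdf ha hz0) hyz]
      with N h1 h2 h3
    exact ((le_max_left _ _).trans_lt hz).trans_le
      (le_gammaCoCdfInv (div_pos ha h1) h2 (lt_of_mul_lt_mul_left h3 h1.le))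
  · intro x hx
    obtain ⟨z, hz, hzx⟩ := exists_lt_of_csInf_lt (levyTailInv_set_nonempty ha hy) hx
    -- At `z` only `L(z) ≤ y` is known; moving right to `z'` makes it strict.
    obtain ⟨z', hzz', hz'x⟩ := exists_between hzx
    have hlt : levyTail a z' < y := (levyTail_lt ha hz.1 hzz').trans_le hz.2
    filter_upwards [hN, hp1, (tendsto_natCast_mul_gammaCoCdf ha
      (hz.1.trans hzz')).eventually_lt hp hlt] with N h1 h2 h3
    exact (gammaCoCdfInv_le_of_le (div_pos ha h1) h2
      (lt_of_mul_lt_mul_left h3 h1.le).le).trans_lt hz'x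

/-! ### Discrete measures with dominated weights -/

/-- The discrete measure with mass `w i` at `y i`. -/
noncomputable def weightedDirac (w y : ℕ → ℝ) : Measure ℝ :=
  Measure.sum fun i => ENNReal.ofReal (w i) • Measure.dirac (y i)

lemma integral_weightedDirac {w : ℕ → ℝ} (hw : ∀ i, 0 ≤ w i) (y : ℕ → ℝ) (f : ℝ → ℝ) :
    ∫ x, f x ∂weightedDirac w y = ∑' i, w i * f (y i) := by
  rw [weightedDirac, integral_sum_dirac fun i => ENNReal.ofReal_ne_top]
  simp only [ENNReal.toReal_ofReal (hw _), smul_eq_mul]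

lemma indicator_one_mem_Icc (s : Set ℝ) (x : ℝ) :
    s.indicator (1 : ℝ → ℝ) x ∈ Set.Icc (0 : ℝ) 1 := by
  by_cases h : x ∈ s <;> simp [h]

lemma weightedDirac_real_Iic {w : ℕ → ℝ} (hw : ∀ i, 0 ≤ w i) (y : ℕ → ℝ) (x : ℝ) :
    (weightedDirac w y).real (Set.Iic x) = ∑' i, w i * (Set.Iic x).indicator 1 (y i) := by
  rw [← integral_weightedDirac hw, integral_indicator_one measurableSet_Iic]

lemma cvmDist_weightedDirac (w : ℕ → ℝ) {v : ℕ → ℝ} (hv : ∀ i, 0 ≤ v i)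
    (y z : ℕ → ℝ) :
    cvmDist (weightedDirac w y) (weightedDirac v z) =
      ∑' j, v j * ((weightedDirac w y).real (Set.Iic (z j)) -
        (weightedDirac v z).real (Set.Iic (z j))) ^ 2 := by
  rw [cvmDist, integral_weightedDirac hv]

lemma weightedDirac_real_le {w b : ℕ → ℝ} (hb : Summable b) (hw : ∀ i, 0 ≤ w i)
    (hwb : ∀ i, w i ≤ b i) (y : ℕ → ℝ) (x : ℝ) :
    (weightedDirac w y).real (Set.Iic x) ≤ ∑' i, b i := by
  rw [weightedDirac_real_Iic hw]
  have h : ∀ i, w i * (Set.Iic x).indicator 1 (y i) ≤ b i := fun i => by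
    refine (mul_le_of_le_one_right (hw i) ?_).trans (hwb i)
    exact indicator_one_mem_Icc _ _ |>.2
  have h0 : ∀ i, 0 ≤ w i * (Set.Iic x).indicator (1 : ℝ → ℝ) (y i) := fun i =>
    mul_nonneg (hw i) (indicator_one_mem_Icc _ _ |>.1)
  exact (Summable.of_nonneg_of_le h0 h hb).tsum_le_tsum h hb

/-- The weights `w n` converge to `w'` termwise, and are dominated by a summable sequence. -/
structure DominatedWeights {ι : Type*} (l : Filter ι) (w : ι → ℕ → ℝ) (w' b : ℕ → ℝ) : Prop where
  summable : Summable b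
  tendsto : ∀ i, Tendsto (fun n => w n i) l (𝓝 (w' i))
  bound : ∀ᶠ n in l, ∀ i, 0 ≤ w n i ∧ w n i ≤ b i

namespace DominatedWeights

variable {ι κ : Type*} {l : Filter ι} {w : ι → ℕ → ℝ} {w' b : ℕ → ℝ}

lemma limit_nonneg [l.NeBot] (h : DominatedWeights l w w' b) (i : ℕ) : 0 ≤ w' i :=
  ge_of_tendsto (h.tendsto i) (h.bound.mono fun _ hn => (hn i).1)

lemma tendsto_tsum (h : DominatedWeights l w w' b) :
    Tendsto (fun n => ∑' i, w n i) l (𝓝 (∑' i, w' i)) := by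
  refine tendsto_tsum_of_dominated_convergence h.summable h.tendsto (h.bound.mono fun n hn i => ?_)
  rw [Real.norm_of_nonneg (hn i).1]
  exact (hn i).2

lemma comp {k : Filter κ} {φ : κ → ι} (h : DominatedWeights l w w' b) (hφ : Tendsto φ k l) :
    DominatedWeights k (fun n => w (φ n)) w' b :=
  ⟨h.summable, fun i => (h.tendsto i).comp hφ, hφ.eventually h.bound⟩

lemma normalize [l.NeBot] (h : DominatedWeights l w w' b) (hpos : 0 < ∑' i, w' i) :
    DominatedWeights l (fun n i => w n i / ∑' j, w n j) (fun i => w' i / ∑' j, w' j)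
      (fun i => b i / ((∑' j, w' j) / 2)) := by
  refine ⟨h.summable.div_const _, fun i => (h.tendsto i).div h.tendsto_tsum hpos.ne', ?_⟩
  -- Eventually the normalizer exceeds half its positive limit, whence the constant in the new
  -- bound.
  filter_upwards [h.bound, h.tendsto_tsum.eventually (lt_mem_nhds (half_lt_self hpos))]
    with n hn hS i
  have hS' : 0 < ∑' j, w n j := (half_pos hpos).trans hS
  refine ⟨div_nonneg (hn i).1 hS'.le, ?_⟩
  exact div_le_div₀ ((hn i).1.trans (hn i).2) (hn i).2 (half_pos hpos) hS.le

lemma tendsto_real_Iic [l.NeBot] (h : DominatedWeights l w w' b) (y : ℕ → ℝ) (x : ℝ) :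
    Tendsto (fun n => (weightedDirac (w n) y).real (Set.Iic x)) l
      (𝓝 ((weightedDirac w' y).real (Set.Iic x))) := by
  rw [weightedDirac_real_Iic h.limit_nonneg]
  have ht : Tendsto (fun n => ∑' i, w n i * (Set.Iic x).indicator 1 (y i)) l
      (𝓝 (∑' i, w' i * (Set.Iic x).indicator 1 (y i))) := by
    refine tendsto_tsum_of_dominated_convergence h.summable
      (fun i => (h.tendsto i).mul_const _) (h.bound.mono fun n hn i => ?_)
    rw [Real.norm_of_nonneg (mul_nonneg (hn i).1 (indicator_one_mem_Icc _ _ |>.1))]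
    exact (mul_le_of_le_one_right (hn i).1 (indicator_one_mem_Icc _ _ |>.2)).trans (hn i).2
  refine ht.congr' (h.bound.mono fun n hn => ?_)
  exact (weightedDirac_real_Iic (fun i => (hn i).1) y x).symm

/-- The atoms do not move, so the integral against a varying measure is a series with fixed index
set. Both cdfs lie between `0` and the totals of their bounds, which controls the square uniformly.
-/
lemma tendsto_cvmDist [l.NeBot] {v : ι → ℕ → ℝ} {v' c : ℕ → ℝ} (h : DominatedWeights l w w' b)
    (hv : DominatedWeights l v v' c) (y z : ℕ → ℝ) :
    Tendsto (fun n => cvmDist (weightedDirac (w n) y) (weightedDirac (v n) z)) l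
      (𝓝 (cvmDist (weightedDirac w' y) (weightedDirac v' z))) := by
  rw [cvmDist_weightedDirac _ hv.limit_nonneg]
  have ht := tendsto_tsum_of_dominated_convergence (𝓕 := l)
    (f := fun n j => v n j * ((weightedDirac (w n) y).real (Set.Iic (z j)) -
      (weightedDirac (v n) z).real (Set.Iic (z j))) ^ 2)
    (bound := fun j => c j * (∑' i, b i + ∑' i, c i) ^ 2) (hv.summable.mul_right _)
    (fun j => (hv.tendsto j).mul
      (((h.tendsto_real_Iic y (z j)).sub (hv.tendsto_real_Iic z (z j))).pow 2)) ?_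
  · refine ht.congr' ?_
    filter_upwards [hv.bound] with n hvn
    exact (cvmDist_weightedDirac _ (fun i => (hvn i).1) y z).symm
  · filter_upwards [h.bound, hv.bound] with n hn hvn j
    have h1 := weightedDirac_real_le h.summable (fun i => (hn i).1) (fun i => (hn i).2) y (z j)
    have h2 := weightedDirac_real_le hv.summable (fun i => (hvn i).1) (fun i => (hvn i).2) z (z j)
    have h3 : 0 ≤ (weightedDirac (w n) y).real (Set.Iic (z j)) := measureReal_nonneg
    have h4 : 0 ≤ (weightedDirac (v n) z).real (Set.Iic (z j)) := measureReal_nonneg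
    rw [Real.norm_of_nonneg (mul_nonneg (hvn j).1 (sq_nonneg _))]
    refine mul_le_mul (hvn j).2 ?_ (sq_nonneg _) ((hvn j).1.trans (hvn j).2)
    exact sq_le_sq' (by linarith) (by linarith)

end DominatedWeights

/-! ### Arrival times and the weights of the approximation -/

lemma arrival_strictMono {e : ℕ → ℝ} (he : ∀ i, 0 < e i) : StrictMono (arrival e) :=
  strictMono_nat_of_lt_succ fun n => by
    rw [arrival, arrival, Finset.sum_range_succ]
    linarith [he n]

lemma arrival_succ_pos {e : ℕ → ℝ} (he : ∀ i, 0 < e i) (n : ℕ) : 0 < arrival e (n + 1) :=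
  Finset.sum_pos (fun i _ => he i) (by simp)

lemma tendsto_arrival_succ_div {e : ℕ → ℝ}
    (h : Tendsto (fun n : ℕ => arrival e n / n) atTop (𝓝 1)) :
    Tendsto (fun n : ℕ => arrival e (n + 1) / n) atTop (𝓝 1) := by
  have h1 := ((tendsto_add_atTop_iff_nat 1).2 h).mul
    (tendsto_one_div_atTop_nhds_zero_nat (𝕜 := ℝ) |>.const_add 1)
  simp only [add_zero, mul_one] at h1
  refine h1.congr' ?_
  filter_upwards [eventually_gt_atTop 0] with n hn
  have hn' : (0 : ℝ) < n := by exact_mod_cast hn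
  push_cast
  field_simp

lemma exists_inv_arrival_le {e : ℕ → ℝ} (h : Tendsto (fun n : ℕ => arrival e n / n) atTop (𝓝 1)) :
    ∃ K > 0, ∀ i : ℕ, (arrival e (i + 1))⁻¹ ≤ K * (i + 1 : ℝ)⁻¹ := by
  obtain ⟨K, hK⟩ := (((tendsto_add_atTop_iff_nat 1).2 h).inv₀ one_ne_zero).bddAbove_range
  -- The maximum with `1` only secures positivity.
  refine ⟨max K 1, by positivity, fun i => ?_⟩
  have h1 : (arrival e (i + 1) / ((i + 1 : ℕ) : ℝ))⁻¹ ≤ K := hK ⟨i, rfl⟩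
  have hi : (0 : ℝ) < i + 1 := by positivity
  rw [inv_div, Nat.cast_succ] at h1
  calc (arrival e (i + 1))⁻¹ = (i + 1 : ℝ) / arrival e (i + 1) * (i + 1 : ℝ)⁻¹ := by field_simp
    _ ≤ _ := by gcongr; exact h1.trans (le_max_left _ _)

/-- The unnormalized weights of `approxDP`. -/
noncomputable def approxWeight (a : ℝ) (e : ℕ → ℝ) (N i : ℕ) : ℝ :=
  if i < N then gammaCoCdfInv (a / N) (arrival e (i + 1) / arrival e (N + 1)) else 0

lemma tsum_approxWeight (a : ℝ) (e : ℕ → ℝ) (N : ℕ) :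
    ∑' i, approxWeight a e N i = ∑ j ∈ Finset.range N,
      gammaCoCdfInv (a / N) (arrival e (j + 1) / arrival e (N + 1)) := by
  simp only [approxWeight]
  rw [tsum_eq_sum (s := Finset.range N) fun i hi => if_neg (by simpa using hi)]
  exact Finset.sum_congr rfl fun i hi => if_pos (Finset.mem_range.1 hi)

lemma approxDP_eq (a : ℝ) (e y : ℕ → ℝ) (N : ℕ) :
    approxDP a e y N =
      weightedDirac (fun i => approxWeight a e N i / ∑' j, approxWeight a e N j) y := by
  ext s hs
  rw [weightedDirac, Measure.sum_apply _ hs, approxDP, Measure.finsetSum_apply,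
    tsum_eq_sum (s := Finset.range N)]
  · refine Finset.sum_congr rfl fun i hi => ?_
    rw [tsum_approxWeight, approxWeight, if_pos (Finset.mem_range.1 hi)]
  · intro i hi
    rw [approxWeight, if_neg (by simpa using hi)]
    simp

lemma exists_dominatedWeights {a : ℝ} (ha : 0 < a) {e : ℕ → ℝ} (he : ∀ i, 0 < e i)
    (h : Tendsto (fun n : ℕ => arrival e n / n) atTop (𝓝 1)) :
    ∃ b, DominatedWeights atTop (approxWeight a e)
      (fun i => levyTailInv a (arrival e (i + 1))) b := by
  obtain ⟨K, hK, hKi⟩ := exists_inv_arrival_le h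
  have hs := tendsto_arrival_succ_div h
  have hN : ∀ᶠ N : ℕ in atTop, (0 : ℝ) < N := by
    filter_upwards [eventually_gt_atTop 0] with N hN
    exact_mod_cast hN
  -- The constant of the quantile bound is of order `1 / N` and `Γ_{N+1}` of order `N`, so their
  -- product stays bounded, eventually by `M`.
  have hR : Tendsto (fun N : ℕ => (Real.Gamma (a / N))⁻¹ * Real.Gamma (a / N + 1 / 2) *
      arrival e (N + 1)) atTop (𝓝 (a * Real.Gamma (1 / 2))) := by
    have h1 := (((tendsto_Gamma_add ha one_pos).inv₀ (by simp)).const_mul a |>.mul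
      (tendsto_Gamma_add ha (c := 1 / 2) (by norm_num))).mul hs
    simp only [Real.Gamma_one, inv_one, mul_one] at h1
    refine h1.congr' ?_
    filter_upwards [hN] with N hN
    rw [inv_Gamma_eq (div_pos ha hN)]
    field_simp
  set M := a * Real.Gamma (1 / 2) + 1 with hM
  refine ⟨fun i => (M * K) ^ 2 * ((i + 1 : ℝ) ^ 2)⁻¹, ?_, ?_, ?_⟩
  · refine Summable.mul_left _ ?_
    have := (summable_nat_add_iff 1).2 (Real.summable_nat_pow_inv.2 one_lt_two)
    simpa using this
  · intro i
    have hp : Tendsto (fun N : ℕ => N * (arrival e (i + 1) / arrival e (N + 1))) atTop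
        (𝓝 (arrival e (i + 1))) := by
      have h1 := (hs.inv₀ one_ne_zero).const_mul (arrival e (i + 1))
      rw [inv_one, mul_one] at h1
      refine h1.congr fun N => ?_
      rw [inv_div]
      ring
    refine (tendsto_gammaCoCdfInv ha (arrival_succ_pos he i) hp).congr' ?_
    filter_upwards [eventually_gt_atTop i] with N hN
    rw [approxWeight, if_pos hN]
  · filter_upwards [hN, hR.eventually (gt_mem_nhds (lt_add_one _))] with N hN hRN i
    have hα : 0 < a / N := div_pos ha hN
    unfold approxWeight
    split_ifs with hi
    · have hΓi := arrival_succ_pos he i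
      have hΓN := arrival_succ_pos he N
      have hp0 : 0 < arrival e (i + 1) / arrival e (N + 1) := div_pos hΓi hΓN
      have hp1 : arrival e (i + 1) / arrival e (N + 1) < 1 :=
        (div_lt_one hΓN).2 (arrival_strictMono he (by omega))
      have hG1 := Real.Gamma_pos_of_pos hα
      have hG2 := Real.Gamma_pos_of_pos (show 0 < a / N + 1 / 2 by linarith)
      refine ⟨gammaCoCdfInv_nonneg hα hp1, (gammaCoCdfInv_le hα hp0 hp1).trans ?_⟩
      -- Dividing by `p = Γ_i / Γ_{N+1}` regroups the bound as the square of the product bounded by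
      -- `M` times `Γ_i⁻¹`, and the latter is at most `K / i`, in numbering from `1`.
      rw [← inv_pow, ← mul_pow, div_div_eq_mul_div, div_eq_mul_inv, mul_assoc M]
      gcongr
      exact hKi i
    · exact ⟨le_rfl, by positivity⟩

lemma exists_dominatedWeights_normalized {a : ℝ} (ha : 0 < a) {e : ℕ → ℝ} (he : ∀ i, 0 < e i)
    (h : Tendsto (fun n : ℕ => arrival e n / n) atTop (𝓝 1)) :
    ∃ b, DominatedWeights atTop
      (fun N i => approxWeight a e N i / ∑' j, approxWeight a e N j)
      (fun i => levyTailInv a (arrival e (i + 1)) / ∑' j, levyTailInv a (arrival e (j + 1))) b := by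
  obtain ⟨b, hb⟩ := exists_dominatedWeights ha he h
  have hle : ∀ i, levyTailInv a (arrival e (i + 1)) ≤ b i := fun i =>
    le_of_tendsto (hb.tendsto i) (hb.bound.mono fun n hn => (hn i).2)
  have hsum := Summable.of_nonneg_of_le hb.limit_nonneg hle hb.summable
  exact ⟨_, hb.normalize
    (hsum.tsum_pos hb.limit_nonneg 0 (levyTailInv_pos ha (arrival_succ_pos he 0)))⟩

lemma tendsto_cvmDist_approxDP {a₁ a₂ : ℝ} (ha₁ : 0 < a₁) (ha₂ : 0 < a₂) {e₁ e₂ : ℕ → ℝ}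
    (he₁ : ∀ i, 0 < e₁ i) (he₂ : ∀ i, 0 < e₂ i)
    (h₁ : Tendsto (fun n : ℕ => arrival e₁ n / n) atTop (𝓝 1))
    (h₂ : Tendsto (fun n : ℕ => arrival e₂ n / n) atTop (𝓝 1)) (y₁ y₂ : ℕ → ℝ) :
    Tendsto (fun N : ℕ × ℕ => cvmDist (approxDP a₁ e₁ y₁ N.1) (approxDP a₂ e₂ y₂ N.2))
      (atTop ×ˢ atTop) (𝓝 (cvmDist (seriesDP a₁ e₁ y₁) (seriesDP a₂ e₂ y₂))) := by
  obtain ⟨b, hb⟩ := exists_dominatedWeights_normalized ha₁ he₁ h₁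
  obtain ⟨c, hc⟩ := exists_dominatedWeights_normalized ha₂ he₂ h₂
  simp only [approxDP_eq]
  -- `seriesDP` is definitionally a `weightedDirac`; each one-index domination is pulled back along
  -- a projection to the pair `(N₁, N₂)`.
  exact (hb.comp tendsto_fst).tendsto_cvmDist (hc.comp tendsto_snd) y₁ y₂

/-! ### Exponential variables and the strong law -/

lemma expMeasure_one_Iic_zero : expMeasure 1 (Set.Iic 0) = 0 := by
  have := isProbabilityMeasure_expMeasure one_pos
  have h1 := cdf_expMeasure_eq one_pos 0
  rw [cdf_eq_real] at h1
  simp only [le_refl, if_true, mul_zero, neg_zero, Real.exp_zero, sub_self] at h1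
  exact (measureReal_eq_zero_iff).1 h1

lemma ae_pos_expMeasure_one : ∀ᵐ x ∂expMeasure 1, 0 < x := by
  simp only [ae_iff, not_lt]
  exact expMeasure_one_Iic_zero

lemma integrable_and_integral_expMeasure_one :
    Integrable (fun x : ℝ => x) (expMeasure 1) ∧ ∫ x, x ∂expMeasure 1 = 1 := by
  have hm : Measurable (gammaPDF 1 1) := (measurable_gammaPDFReal 1 1).ennreal_ofReal
  have hfin : ∀ᵐ x : ℝ, gammaPDF 1 1 x < ⊤ := ae_of_all _ fun x => ENNReal.ofReal_lt_top
  -- Multiplying the exponential density by `x` gives the integrand of `Γ(2) = 1`.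
  have heq : (fun x : ℝ => (gammaPDF 1 1 x).toReal • x) =
      (Set.Ioi 0).indicator fun x => Real.exp (-x) * x ^ ((2 : ℝ) - 1) := by
    ext x
    rw [gammaPDF, ENNReal.toReal_ofReal (gammaPDFReal_nonneg one_pos one_pos x), gammaPDFReal]
    rcases lt_trichotomy x 0 with hx | hx | hx
    · simp [hx.not_ge, hx.le.not_gt]
    · simp [hx]
    · have h2 : (2 : ℝ) - 1 = 1 := by norm_num
      simp [hx.le, hx, h2]
  constructor
  · rw [expMeasure, gammaMeasure, integrable_withDensity_iff_integrable_smul' hm hfin, heq]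
    exact (integrable_indicator_iff measurableSet_Ioi).2
      (Real.GammaIntegral_convergent two_pos)
  · rw [expMeasure, gammaMeasure, integral_withDensity_eq_integral_toReal_smul hm hfin, heq,
      integral_indicator measurableSet_Ioi, ← Real.Gamma_eq_integral two_pos, Real.Gamma_two]

lemma IsSeriesInput.ae_good {Ω : Type*} [MeasurableSpace Ω] {μ : Measure Ω} {H : Measure ℝ}
    {E Y : ℕ → Ω → ℝ} (h : IsSeriesInput μ H E Y) :
    ∀ᵐ ω ∂μ, (∀ i, 0 < E i ω) ∧
      Tendsto (fun n : ℕ => arrival (fun i => E i ω) n / n) atTop (𝓝 1) := by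
  have hpos : ∀ᵐ ω ∂μ, ∀ i, 0 < E i ω := ae_all_iff.2 fun i =>
    ((h.hasLaw_exp i).ae_iff (p := fun x => 0 < x)
      measurableSet_Ioi.mem).2 ae_pos_expMeasure_one
  have hint : Integrable (E 0) μ := by
    have h1 := integrable_and_integral_expMeasure_one.1
    rw [← (h.hasLaw_exp 0).map_eq] at h1
    exact h1.comp_aemeasurable (h.hasLaw_exp 0).aemeasurable
  have hmean : ∫ ω, E 0 ω ∂μ = 1 := by
    rw [(h.hasLaw_exp 0).integral_eq, integrable_and_integral_expMeasure_one.2]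
  have hslln := strong_law_ae_real E hint (fun i j hij => h.iIndep_exp.indepFun hij)
    fun i => ⟨(h.hasLaw_exp i).aemeasurable, (h.hasLaw_exp 0).aemeasurable,
      (h.hasLaw_exp i).map_eq.trans (h.hasLaw_exp 0).map_eq.symm⟩
  rw [hmean] at hslln
  filter_upwards [hpos, hslln] with ω h1 h2
  exact ⟨h1, h2⟩

end DPApprox

theorem mainTheorem5 {Ω : Type*} [MeasurableSpace Ω] (μ : Measure Ω) [IsProbabilityMeasure μ]
    (a₁ a₂ : ℝ) (ha₁ : 0 < a₁) (ha₂ : 0 < a₂)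
    (H₁ H₂ : Measure ℝ) [IsProbabilityMeasure H₁] [IsProbabilityMeasure H₂]
    (P Q : Kernel Ω ℝ) [IsMarkovKernel P] [IsMarkovKernel Q]
    (hP : DPApprox.IsDirichletProcess μ P a₁ H₁)
    (hQ : DPApprox.IsDirichletProcess μ Q a₂ H₂)
    (E₁ Y₁ E₂ Y₂ : ℕ → Ω → ℝ)
    (hEY₁ : DPApprox.IsSeriesInput μ H₁ E₁ Y₁)
    (hEY₂ : DPApprox.IsSeriesInput μ H₂ E₂ Y₂)
    (hPs : ∀ᵐ ω ∂μ, P ω = DPApprox.seriesDP a₁ (fun i => E₁ i ω) (fun i => Y₁ i ω))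
    (hQs : ∀ᵐ ω ∂μ, Q ω = DPApprox.seriesDP a₂ (fun i => E₂ i ω) (fun i => Y₂ i ω)) :
    ∀ᵐ ω ∂μ, Tendsto
      (fun N : ℕ × ℕ => DPApprox.cvmDist
        (DPApprox.approxDP a₁ (fun i => E₁ i ω) (fun i => Y₁ i ω) N.1)
        (DPApprox.approxDP a₂ (fun i => E₂ i ω) (fun i => Y₂ i ω) N.2))
      (atTop ×ˢ atTop) (𝓝 (DPApprox.cvmDist (P ω) (Q ω))) := by
  filter_upwards [hPs, hQs, hEY₁.ae_good, hEY₂.ae_good] with ω h1 h2 h3 h4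
  rw [h1, h2]
  exact DPApprox.tendsto_cvmDist_approxDP ha₁ ha₂ h3.1 h4.1 h3.2 h4.2 _ _
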